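/- Let $G$ be a connected finite simple undirected graph on $n\ge 5$ vertices with minimum degree $\delta\ge 3$. Let $Q_D(G)=\mathrm{Tr}(G)+\mathcal{D}(G)$ be its distance signless Laplacian matrix, where $\mathcal{D}(G)$ is the matrix whose $(u,v)$ entry is the graph distance $d_G(u,v)$ and $\mathrm{Tr}(G)$ is the diagonal matrix whose $u$-th entry is $\sum_{v\in V(G)}d_G(u,v)$. Let $\rho_D(G)$ be the largest eigenvalue of $Q_D(G)$. If $$\rho_D(G)\le\frac{2n^2+6n-36}{n},$$ then $G$ is Hamilton-connected, that is, every two distinct vertices of $G$ are connected by a Hamilton path (a path through all the vertices of $G$). -/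

import Mathlib

namespace SimpleGraph

/-- The distance matrix, whose `(u, v)` entry is the graph distance between `u` and `v`. -/
noncomputable def distanceMatrix {V : Type*} (G : SimpleGraph V) : Matrix V V ℝ :=
  Matrix.of fun u v => (G.dist u v : ℝ)

/-- The transmission of a vertex: the sum of its distances to all the vertices. -/
noncomputable def transmission {V : Type*} [Fintype V] (G : SimpleGraph V) (u : V) : ℕ :=
  ∑ v, G.dist u v

/-- The distance signless Laplacian: the diagonal matrix of the transmissions plus the distance
matrix. -/
noncomputable def distanceSignlessLaplacian {V : Type*} [Fintype V] [DecidableEq V]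
    (G : SimpleGraph V) : Matrix V V ℝ :=
  Matrix.diagonal (fun u => (G.transmission u : ℝ)) + G.distanceMatrix

/-- The distance signless Laplacian spectral radius: the largest eigenvalue of the distance
signless Laplacian. (For a non-empty vertex set the supremum is a maximum, because the matrix is
real symmetric of positive order, and so has a non-empty finite set of real eigenvalues.) -/
noncomputable def distanceSignlessSpectralRadius {V : Type*} [Fintype V] [DecidableEq V]
    (G : SimpleGraph V) : ℝ :=
  sSup {μ : ℝ | Module.End.HasEigenvalue (Matrix.toLin' G.distanceSignlessLaplacian) μ}

/-- Every two distinct vertices are the ends of a Hamilton path. -/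
def IsHamiltonConnected {V : Type*} [DecidableEq V] (G : SimpleGraph V) : Prop :=
  ∀ u v : V, u ≠ v → ∃ p : G.Walk u v, p.IsHamiltonian

end SimpleGraph

/-!
Suppose that `G` has no Hamilton path from `s` to `t`, and take a maximal supergraph `H` of `G`
with this property. By the exchange argument of Ore and Bondy–Chvátal
(`exists_le_degree_add_degree_le`), the degrees of two vertices non-adjacent in `H` sum to at most
`n`. A count over a non-adjacent pair with maximal degree sum (`exists_sum_degree_add_le`) then
gives, for the degree `k ≥ 3` of some vertex, with `2 k ≤ n`,
`∑ deg_H ≤ n (n - 1) - (k - 1) (2 n - 3 k)`.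

On the other hand, the Rayleigh quotient of the all-ones vector shows that `ρ ≥ 2 ∑ Tr / n`, and
`Tr(u) ≥ 2 (n - 1) - deg_H(u)`, so that the bound on `ρ` yields `∑ deg_H ≥ n² - 5 n + 18`. Equality
would make the all-ones vector an eigenvector, hence `G` transmission regular, which forces the
degrees of `H` to be too large for a non-adjacent pair; so the inequality is strict
(`lt_sum_degree`).

The two estimates are compatible only if `(k - 3) (2 n - 3 k - 6) < 0`, which leaves
`(k, n) = (4, 8)` and `(5, 10)`. There `H` must be the join of a complete graph on `k` vertices with
`k` isolated vertices (`isIndep_of_sum_degree_ge`), and a test vector with values `2` on the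
independent set and `1` elsewhere shows that `ρ ≥ (27 k - 18) / 5`, which exceeds the bound
(`sub_le_five_mul_spectralRadius_of_isIndep`).
-/

/-! ### Paths as lists and the Bondy–Chvátal exchange -/

namespace List

/-- Along a list, no entry satisfying `P` is followed by one satisfying `Q`, and the last entry
does not satisfy `P`: then passing to the successor injects the entries satisfying `P` into the
entries of the tail violating `Q`. -/
theorem countP_add_countP_tail_lt_length {α : Type*} (P Q : α → Bool) :
    ∀ (l : List α) (hl : l ≠ []), l.IsChain (fun a b => ¬(P a ∧ Q b)) → ¬ P (l.getLast hl) →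
      l.countP P + l.tail.countP Q < l.length
  | [a], _, _, h => by simpa using h
  | a :: b :: l, _, hc, h => by
    have ih := countP_add_countP_tail_lt_length P Q (b :: l) (by simp) hc.of_cons (by simpa using h)
    have hab := hc.rel
    simp only [tail_cons, countP_cons, length_cons] at ih ⊢
    grind

theorem countP_add_countP_le_length {α : Type*} (P Q : α → Bool) (l : List α) (hl : l ≠ [])
    (hc : l.IsChain (fun a b => ¬(P a ∧ Q b))) (h : ¬ P (l.getLast hl)) :
    l.countP P + l.countP Q ≤ l.length := by
  have := countP_add_countP_tail_lt_length P Q l hl hc h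
  cases l with
  | nil => contradiction
  | cons a l =>
    simp only [tail_cons, countP_cons (p := Q)] at this ⊢
    split_ifs <;> omega

theorem exists_append_cons_cons_of_not_isChain {α : Type*} {R : α → α → Prop} {l : List α}
    (h : ¬ l.IsChain R) : ∃ A a b B, l = A ++ a :: b :: B ∧ ¬ R a b := by
  rw [isChain_iff_forall_rel_of_append_cons_cons] at h
  push Not at h
  obtain ⟨a, b, A, B, h1, h2⟩ := h
  exact ⟨A, a, b, B, h1, h2⟩

end List

namespace SimpleGraph

variable {V : Type*} [DecidableEq V]

/-- The list `l` is the sequence of vertices of a Hamilton path of `H` from `s` to `t`. Lists are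
used instead of walks because they can be cut, reversed and joined without transporting the
end-points in the type. -/
def IsHamiltonianList (H : SimpleGraph V) (s t : V) (l : List V) : Prop :=
  l.IsChain H.Adj ∧ (∀ a, l.count a = 1) ∧ l.head? = some s ∧ l.getLast? = some t

theorem IsHamiltonianList.exists_walk {H : SimpleGraph V} {s t : V} {l : List V}
    (hl : H.IsHamiltonianList s t l) : ∃ p : H.Walk s t, p.IsHamiltonian := by
  obtain ⟨hc, hcount, hs, ht⟩ := hl
  have hne : l ≠ [] := by rintro rfl; simp at hs
  have hs' : l.head hne = s := by
    rw [List.head?_eq_some_head hne] at hs; simpa using hs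
  have ht' : l.getLast hne = t := by
    rw [List.getLast?_eq_some_getLast hne] at ht; simpa using ht
  subst hs' ht'
  exact ⟨Walk.ofSupport l hne hc, fun a => by rw [Walk.support_ofSupport]; exact hcount a⟩

theorem exists_isHamiltonianList_top [Fintype V] {s t : V} (hst : s ≠ t) :
    ∃ l, (⊤ : SimpleGraph V).IsHamiltonianList s t l := by
  let m := ((Finset.univ.erase s).erase t).toList
  have hnd : (s :: (m ++ [t])).Nodup := by
    simp +contextual [m, List.nodup_append, Finset.nodup_toList, hst]
  refine ⟨s :: (m ++ [t]), ?_, ?_, by simp, by simp [List.getLast?_cons]⟩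
  · exact List.Pairwise.isChain (hnd.imp fun h => h)
  · intro a
    apply List.count_eq_one_of_mem hnd
    simp only [List.mem_cons, List.mem_append, m, Finset.mem_toList, Finset.mem_erase]
    by_cases h1 : a = s <;> by_cases h2 : a = t <;> simp [h1, h2]

variable [Fintype V] (H : SimpleGraph V) [DecidableRel H.Adj]

theorem degree_eq_countP {l : List V} (hl : ∀ a, l.count a = 1) (u : V) :
    H.degree u = l.countP (fun a => decide (H.Adj u a)) := by
  have hnd : l.Nodup := List.nodup_iff_count_le_one.2 fun a => (hl a).le
  have hmem : ∀ a, a ∈ l := fun a => List.count_pos_iff.1 (by rw [hl a]; exact one_pos)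
  rw [List.countP_eq_length_filter, ← List.toFinset_card_of_nodup (hnd.filter _),
    ← card_neighborFinset_eq_degree]
  congr 1
  ext a
  simp [hmem a]

theorem length_eq_card {l : List V} (hl : ∀ a, l.count a = 1) : l.length = Fintype.card V := by
  have hnd : l.Nodup := List.nodup_iff_count_le_one.2 fun a => (hl a).le
  have hmem : ∀ a, a ∈ l := fun a => List.count_pos_iff.1 (by rw [hl a]; exact one_pos)
  rw [← List.toFinset_card_of_nodup hnd, ← Finset.card_univ]
  congr 1
  ext a
  simp [hmem a]

variable {H}

/-- The two pieces `A` and `B` of a Hamilton path from which the link `u v` is missing. If `A` has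
consecutive vertices `a, b` with `a` adjacent to `u` and `b` adjacent to `v`, reversing the part
of `A` from `b` to its end `u` gives a Hamilton path; likewise with `B`. Otherwise the
neighbourhoods of `u` and `v` are too small. -/
theorem degree_add_degree_le_of_pieces {s t u v : V} {A B : List V}
    (hA : A.IsChain H.Adj) (hB : B.IsChain H.Adj) (hcount : ∀ a, (A ++ B).count a = 1)
    (hs : A.head? = some s) (hu : A.getLast? = some u) (hv : B.head? = some v)
    (ht : B.getLast? = some t) (hno : ¬ ∃ l, H.IsHamiltonianList s t l) :
    H.degree u + H.degree v ≤ Fintype.card V := by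
  have hAne : A ≠ [] := by rintro rfl; simp at hs
  have hBne : B ≠ [] := by rintro rfl; simp at hv
  have hAu : A.getLast hAne = u := by
    rw [List.getLast?_eq_some_getLast hAne] at hu; simpa using hu
  have hBv : B.head hBne = v := by
    rw [List.head?_eq_some_head hBne] at hv; simpa using hv
  have hAc : A.IsChain (fun a b => ¬(H.Adj u a ∧ H.Adj v b)) := by
    by_contra hcon
    obtain ⟨X, a, b, Y, rfl, hab⟩ := List.exists_append_cons_cons_of_not_isChain hcon
    push Not at hab
    refine hno ⟨(X ++ [a]) ++ ((b :: Y).reverse ++ B), ?_, ?_, ?_, ?_⟩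
    · have hu' : (b :: Y).reverse.head? = some u := by
        rw [List.head?_reverse, ← hu]; simp [List.getLast?_append, List.getLast?_cons]
      rw [List.isChain_append_cons_cons] at hA
      refine List.isChain_append.2 ⟨hA.1, List.isChain_append.2
        ⟨List.isChain_reverse.2 ?_, hB, ?_⟩, ?_⟩
      · exact hA.2.2.imp fun _ _ h => h.symm
      · simp only [List.getLast?_reverse, List.head?_cons, hv, Option.mem_some_iff]
        rintro _ rfl _ rfl
        exact hab.2.symm
      · rw [List.head?_append, hu']
        simp only [List.getLast?_append, List.getLast?_singleton, Option.some_or,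
          Option.mem_some_iff]
        rintro _ rfl _ rfl
        exact hab.1.symm
    · intro w
      rw [← hcount w]
      apply List.Perm.count_eq
      rw [← List.append_assoc]
      refine List.Perm.append_right _ ?_
      rw [show X ++ a :: b :: Y = (X ++ [a]) ++ (b :: Y) by simp]
      exact (List.reverse_perm _).append_left _
    · rw [← hs]; cases X <;> simp
    · rw [← ht, List.getLast?_append, List.getLast?_append, ht]; simp
  have hBc : B.IsChain (fun a b => ¬(H.Adj u a ∧ H.Adj v b)) := by
    by_contra hcon
    obtain ⟨X, a, b, Y, rfl, hab⟩ := List.exists_append_cons_cons_of_not_isChain hcon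
    push Not at hab
    refine hno ⟨A ++ ((X ++ [a]).reverse ++ (b :: Y)), ?_, ?_, ?_, ?_⟩
    · have hv' : (X ++ [a]).head? = some v := by
        rw [← hv]; cases X <;> simp
      rw [List.isChain_append_cons_cons] at hB
      rw [List.isChain_append, List.isChain_append, List.isChain_reverse]
      refine ⟨hA, ⟨?_, hB.2.2, ?_⟩, ?_⟩
      · exact hB.1.imp fun _ _ h => h.symm
      · simp only [List.getLast?_reverse, List.head?_cons, hv', Option.mem_some_iff]
        rintro _ rfl _ rfl
        exact hab.2
      · simp only [List.reverse_append, List.reverse_singleton, List.cons_append,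
          List.head?_cons, hu, Option.mem_some_iff]
        rintro _ rfl _ rfl
        exact hab.1
    · intro w
      rw [← hcount w]
      apply List.Perm.count_eq
      refine List.Perm.append_left _ ?_
      rw [show X ++ a :: b :: Y = (X ++ [a]) ++ (b :: Y) by simp]
      exact (List.reverse_perm _).append_right _
    · rw [← hs, List.head?_append, hs]; simp
    · rw [← ht]; simp [List.getLast?_append, List.getLast?_cons]
  have h1 := List.countP_add_countP_le_length (fun a => decide (H.Adj u a))
    (fun a => decide (H.Adj v a)) A hAne (by simpa using hAc) (by simp [hAu])
  have h2 := List.countP_add_countP_le_length (fun a => decide (H.Adj v a))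
    (fun a => decide (H.Adj u a)) B.reverse (by simpa using hBne)
    (by rw [List.isChain_reverse]; simpa [and_comm] using hBc) (by simp [hBv])
  simp only [List.countP_reverse, List.length_reverse] at h2
  rw [degree_eq_countP H hcount, degree_eq_countP H hcount, ← length_eq_card hcount,
    List.countP_append, List.countP_append, List.length_append]
  omega

/-- If joining `u` to `v` creates a Hamilton path from `s` to `t` where there was none, then cutting
that path at the link `u v` leaves two pieces as in `degree_add_degree_le_of_pieces`. -/
theorem degree_add_degree_le_of_sup_edge {s t u v : V}
    (hno : ¬ ∃ l, H.IsHamiltonianList s t l)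
    (hyes : ∃ l, (H ⊔ edge u v).IsHamiltonianList s t l) :
    H.degree u + H.degree v ≤ Fintype.card V := by
  obtain ⟨l, hc, hcount, hs, ht⟩ := hyes
  have hnd : l.Nodup := List.nodup_iff_count_le_one.2 fun a => (hcount a).le
  have hnc : ¬ l.IsChain H.Adj := fun h => hno ⟨l, h, hcount, hs, ht⟩
  obtain ⟨A, a, b, B, rfl, hab⟩ := List.exists_append_cons_cons_of_not_isChain hnc
  rw [List.isChain_append_cons_cons] at hc
  obtain ⟨hcA, hcab, hcB⟩ := hc
  have key : (a = u ∧ b = v) ∨ (a = v ∧ b = u) := by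
    rw [sup_adj, edge_adj] at hcab
    tauto
  have hA : (A ++ [a]).IsChain H.Adj := by
    refine hcA.imp_of_mem_imp fun x y hx hy hxy => ?_
    rw [sup_adj, edge_adj] at hxy
    grind
  have hB : (b :: B).IsChain H.Adj := by
    refine hcB.imp_of_mem_imp fun x y hx hy hxy => ?_
    rw [sup_adj, edge_adj] at hxy
    grind
  have := degree_add_degree_le_of_pieces (u := a) (v := b) hA hB (by simpa using hcount)
    (by rw [← hs]; cases A <;> simp) (by simp) (by simp)
    (by rw [← ht]; simp [List.getLast?_append, List.getLast?_cons]) hno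
  rcases key with ⟨rfl, rfl⟩ | ⟨rfl, rfl⟩ <;> omega


/-- A graph with no Hamilton path from `s` to `t` lies in a maximal such graph, which is not
complete and in which the degrees of two non-adjacent vertices sum to at most `n`. -/
theorem exists_le_degree_add_degree_le {G : SimpleGraph V} {s t : V} (hst : s ≠ t)
    (hG : ¬ ∃ l, G.IsHamiltonianList s t l) :
    ∃ (H : SimpleGraph V) (_ : DecidableRel H.Adj), G ≤ H ∧ (∃ u v, u ≠ v ∧ ¬ H.Adj u v) ∧
      ∀ u v, u ≠ v → ¬ H.Adj u v → H.degree u + H.degree v ≤ Fintype.card V := by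
  classical
  obtain ⟨H, hGH, hH⟩ := Finite.exists_le_maximal
    (p := fun K : SimpleGraph V => ¬ ∃ l, K.IsHamiltonianList s t l) hG
  refine ⟨H, Classical.decRel _, hGH, ?_, fun u v huv hadj => ?_⟩
  · by_contra! hcon
    have : H = ⊤ := by
      ext u v
      exact ⟨fun h => h.ne, fun h => hcon u v h⟩
    exact hH.1 (this ▸ exists_isHamiltonianList_top hst)
  · refine degree_add_degree_le_of_sup_edge hH.1 ?_
    by_contra hcon
    have hle := hH.2 hcon le_sup_left
    apply hadj
    apply hle
    simp [edge_adj, huv]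

end SimpleGraph

/-! ### The Rayleigh quotient of the distance signless Laplacian -/

namespace SimpleGraph

variable {V : Type*} [Fintype V] [DecidableEq V] (G : SimpleGraph V)

theorem isHermitian_distanceSignlessLaplacian : G.distanceSignlessLaplacian.IsHermitian := by
  unfold distanceSignlessLaplacian
  refine (Matrix.isHermitian_diagonal _).add ?_
  ext u v
  simp [distanceMatrix, dist_comm]

/-- The spectral radius `ρ` bounds the Rayleigh quotient of the distance signless Laplacian `Q`,
stated as positive semidefiniteness of `ρ - Q` so that vectors attaining the bound are also
controlled. -/
theorem posSemidef_spectralRadius_smul_one_sub :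
    (G.distanceSignlessSpectralRadius • (1 : Matrix V V ℝ)
      - G.distanceSignlessLaplacian).PosSemidef := by
  have hM : (G.distanceSignlessSpectralRadius • (1 : Matrix V V ℝ)
      - G.distanceSignlessLaplacian).IsHermitian := by
    refine Matrix.IsHermitian.sub ?_ G.isHermitian_distanceSignlessLaplacian
    ext u v
    simp [Matrix.one_apply, eq_comm]
  rw [hM.posSemidef_iff_eigenvalues_nonneg]
  intro i
  -- An eigenvalue `μ` of `ρ - Q` gives the eigenvalue `ρ - μ` of `Q`, which is at most `ρ`.
  have hv := hM.mulVec_eigenvectorBasis i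
  have hne : (hM.eigenvectorBasis i).ofLp ≠ 0 := by
    intro h
    have := hM.eigenvectorBasis.orthonormal.ne_zero i
    exact this (by ext j; exact congrFun h j)
  set μ := hM.eigenvalues i
  set w : V → ℝ := (hM.eigenvectorBasis i).ofLp
  have hmem : G.distanceSignlessSpectralRadius - μ ∈
      {μ : ℝ | Module.End.HasEigenvalue (Matrix.toLin' G.distanceSignlessLaplacian) μ} := by
    refine Module.End.hasEigenvalue_of_hasEigenvector (x := w) ⟨?_, hne⟩
    rw [Module.End.mem_eigenspace_iff, Matrix.toLin'_apply, sub_smul, ← hv, Matrix.sub_mulVec,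
      Matrix.smul_mulVec, Matrix.one_mulVec]
    simp
  have := le_csSup (Module.End.finite_hasEigenvalue _).bddAbove hmem
  change _ ≤ G.distanceSignlessSpectralRadius at this
  show 0 ≤ μ
  linarith

theorem distanceSignlessLaplacian_mulVec (x : V → ℝ) (u : V) :
    (G.distanceSignlessLaplacian.mulVec x) u = ∑ v, (G.dist u v : ℝ) * (x u + x v) := by
  rw [distanceSignlessLaplacian, Matrix.add_mulVec, Pi.add_apply, Matrix.mulVec_diagonal]
  simp only [transmission, Matrix.mulVec, dotProduct, distanceMatrix, Matrix.of_apply, mul_add,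
    Finset.sum_add_distrib, Nat.cast_sum, Finset.sum_mul]

/-- The Rayleigh bound `xᵀ Q x ≤ ρ ‖x‖²`, with the quadratic form written in terms of distances. -/
theorem sum_dist_mul_le (x : V → ℝ) :
    ∑ u, ∑ v, (G.dist u v : ℝ) * (x u * (x u + x v)) ≤
      G.distanceSignlessSpectralRadius * ∑ u, x u ^ 2 := by
  have h := G.posSemidef_spectralRadius_smul_one_sub.dotProduct_mulVec_nonneg x
  rw [star_trivial, Matrix.sub_mulVec, Matrix.smul_mulVec, Matrix.one_mulVec,
    dotProduct_sub, dotProduct_smul] at h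
  simp only [dotProduct, distanceSignlessLaplacian_mulVec, smul_eq_mul, Finset.mul_sum] at h
  simp only [Finset.mul_sum]
  have e : ∀ u v, x u * ((G.dist u v : ℝ) * (x u + x v)) =
    (G.dist u v : ℝ) * (x u * (x u + x v)) := fun u v => by ring
  simp only [e, ← pow_two] at h
  linarith

theorem two_mul_sum_transmission_le :
    2 * ∑ u, (G.transmission u : ℝ) ≤ G.distanceSignlessSpectralRadius * Fintype.card V := by
  have h := G.sum_dist_mul_le (fun _ => 1)
  simp only [transmission, Nat.cast_sum, Finset.mul_sum]
  simp only [one_mul, one_pow, Finset.sum_const, Finset.card_univ, nsmul_eq_mul, mul_one] at h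
  refine le_trans (le_of_eq ?_) h
  refine Finset.sum_congr rfl fun u _ => Finset.sum_congr rfl fun v _ => by ring

/-- If the all-ones vector attains the Rayleigh bound, it is an eigenvector, and so the graph is
transmission regular. -/
theorem two_mul_transmission_eq_of_two_mul_sum_eq
    (h : 2 * ∑ u, (G.transmission u : ℝ) = G.distanceSignlessSpectralRadius * Fintype.card V)
    (u : V) : 2 * (G.transmission u : ℝ) = G.distanceSignlessSpectralRadius := by
  have h1 : ∀ u, (G.distanceSignlessLaplacian.mulVec (fun _ => 1)) u =
      2 * (G.transmission u : ℝ) := fun u => by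
    rw [distanceSignlessLaplacian_mulVec, ← Finset.sum_mul, transmission]
    push_cast
    ring
  have h0 := (G.posSemidef_spectralRadius_smul_one_sub.dotProduct_mulVec_zero_iff
    (fun _ => 1)).1 (by
      rw [star_trivial, Matrix.sub_mulVec, Matrix.smul_mulVec, Matrix.one_mulVec,
        dotProduct_sub, dotProduct_smul]
      simp only [dotProduct, h1, smul_eq_mul, one_mul, ← Finset.mul_sum, h]
      simp)
  have := congrFun h0 u
  simp only [Matrix.sub_mulVec, Matrix.smul_mulVec, Matrix.one_mulVec, Pi.sub_apply, h1,
    Pi.smul_apply, smul_eq_mul, Pi.zero_apply] at this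
  linarith

/-- Distinct vertices that are not adjacent in the supergraph `H` are at distance at least two
in `G`. -/
theorem two_mul_card_sub_le_transmission_add_degree (hG : G.Connected) {H : SimpleGraph V}
    [DecidableRel H.Adj] (hGH : G ≤ H) (u : V) :
    2 * Fintype.card V ≤ G.transmission u + H.degree u + 2 := by
  have h1 : ∀ v, 2 ≤ G.dist u v + (if H.Adj u v then 1 else 0) + (if v = u then 2 else 0) := by
    intro v
    by_cases huv : v = u
    · simp [huv]
    · have hpos : 0 < G.dist u v := hG.pos_dist_of_ne (Ne.symm huv)
      by_cases hadj : H.Adj u v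
      · simp [hadj, huv]; omega
      · have : G.dist u v ≠ 1 := fun h => hadj (hGH (dist_eq_one_iff_adj.1 h))
        simp [hadj, huv]; omega
  have h2 := Finset.sum_le_sum fun v (_ : v ∈ Finset.univ) => h1 v
  simp only [Finset.sum_add_distrib, Finset.sum_const, Finset.card_univ, smul_eq_mul,
    Finset.sum_ite_eq', Finset.mem_univ, if_true] at h2
  rw [← Finset.card_filter, ← neighborFinset_eq_filter, card_neighborFinset_eq_degree] at h2
  rw [transmission]
  omega

/-- An independent set on half of the vertices forces a large spectral radius. The test vector is
`2` on the independent set and `1` elsewhere. -/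
theorem sub_le_five_mul_spectralRadius_of_isIndep (hG : G.Connected) {k : ℕ} (hk : 0 < k)
    (hcard : Fintype.card V = 2 * k) (B : Finset V) (hB : B.card = k)
    (hind : ∀ u ∈ B, ∀ v ∈ B, ¬ G.Adj u v) :
    27 * (k : ℝ) - 18 ≤ 5 * G.distanceSignlessSpectralRadius := by
  let b : V → ℝ := fun u => if u ∈ B then 1 else 0
  have hb : ∀ u, b u * b u = b u := fun u => by simp [b]
  have hb0 : ∀ u, 0 ≤ b u := fun u => by simp only [b]; split_ifs <;> norm_num
  have hsum : ∑ u, b u = k := by simp [b, hB]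
  have h := G.sum_dist_mul_le (fun u => 1 + b u)
  -- For `u ≠ v` the left side is `(1 + b u * b v) * (1 + b u) * (2 + b u + b v)` reduced by
  -- `b ^ 2 = b`, the first factor being a lower bound for the distance; the diagonal is removed.
  have hterm : ∀ u v, (2 + 4 * b u + b v + 9 * (b u * b v)) -
      (if u = v then 2 + 14 * b u else 0) ≤
      (G.dist u v : ℝ) * ((1 + b u) * (1 + b u + (1 + b v))) := by
    intro u v
    by_cases huv : u = v
    · subst huv
      simp only [if_true, dist_self, Nat.cast_zero, zero_mul]
      nlinarith [hb u]
    · have hpos : 0 < G.dist u v := hG.pos_dist_of_ne huv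
      have hd : 1 + b u * b v ≤ (G.dist u v : ℝ) := by
        by_cases h2 : u ∈ B ∧ v ∈ B
        · have h1 : G.dist u v ≠ 1 := fun h => hind u h2.1 v h2.2 (dist_eq_one_iff_adj.1 h)
          have : 2 ≤ G.dist u v := by omega
          have : (2 : ℝ) ≤ G.dist u v := by exact_mod_cast this
          simp only [b, h2.1, h2.2, if_true]
          linarith
        · have : (1 : ℝ) ≤ G.dist u v := by exact_mod_cast hpos
          have h0 : b u * b v = 0 := by simp only [b]; grind
          linarith
      have hnn : 0 ≤ (1 + b u) * (1 + b u + (1 + b v)) := by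
        have := hb0 u; have := hb0 v; positivity
      have := mul_le_mul_of_nonneg_right hd hnn
      simp only [huv, if_false, sub_zero]
      refine le_trans (le_of_eq ?_) this
      have e1 := hb u
      have e2 := hb v
      linear_combination (-1 - b v * (4 + b u + b v)) * e1 - (2 * b u) * e2
  have hl := Finset.sum_le_sum fun u (_ : u ∈ Finset.univ) =>
    Finset.sum_le_sum fun v (_ : v ∈ Finset.univ) => hterm u v
  have hr : ∑ u, (1 + b u) ^ 2 = 5 * (k : ℝ) := by
    have : ∀ u, (1 + b u) ^ 2 = 1 + 3 * b u := fun u => by linear_combination hb u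
    simp only [this, Finset.sum_add_distrib, ← Finset.mul_sum, hsum, Finset.sum_const,
      Finset.card_univ, hcard]
    simp
    ring
  rw [hr] at h
  simp only [Finset.sum_sub_distrib, Finset.sum_add_distrib, ← Finset.mul_sum, hsum,
    Finset.sum_const, Finset.card_univ, hcard, ← Finset.sum_mul, Finset.sum_ite_eq,
    Finset.mem_univ, if_true, nsmul_eq_mul] at hl
  have h3 := hl.trans h
  push_cast at h3
  have hk' : (0 : ℝ) < k := by exact_mod_cast hk
  refine le_of_mul_le_mul_left ?_ hk'
  nlinarith [h3]

end SimpleGraph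

/-! ### Counting edges under the Ore condition -/

namespace SimpleGraph

variable {V : Type*} [Fintype V] [DecidableEq V] (H : SimpleGraph V) [DecidableRel H.Adj]

theorem card_filter_not_adj (u : V) :
    (Finset.univ.filter fun w => ¬ H.Adj u w).card = Fintype.card V - H.degree u := by
  rw [← card_neighborFinset_eq_degree, ← Finset.card_compl, neighborFinset_eq_filter,
    Finset.compl_filter]

/-- The edge count in the manner of Chvátal. Among the non-adjacent pairs take `u, v` with
`deg u ≤ deg v` and `deg u + deg v` maximal, and put `k = deg u`. The set `B` consists of `u` and
the vertices not adjacent to `u`, all of degree at most `deg v ≤ n - k`, while the at least `k - 1`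
vertices not adjacent to `v` have degree at most `k`. -/
theorem exists_sum_degree_add_le {n : ℕ} (hn : Fintype.card V = n)
    (hpos : ∀ u, 0 < H.degree u) (hne : ∃ u v, u ≠ v ∧ ¬ H.Adj u v)
    (hore : ∀ u v, u ≠ v → ¬ H.Adj u v → H.degree u + H.degree v ≤ n) :
    ∃ (k : ℕ) (B : Finset V), (∃ u, H.degree u = k) ∧ 2 * k ≤ n ∧ B.card = n - k ∧
      (∀ w ∈ B, H.degree w ≤ n - k) ∧
      ((∑ w, H.degree w : ℕ) : ℤ) + (k - 1) * (2 * n - 3 * k) ≤ n * (n - 1) := by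
  obtain ⟨⟨u, v⟩, hmem, hmax⟩ := Finset.exists_max_image
    (Finset.univ.filter fun p : V × V => p.1 ≠ p.2 ∧ ¬ H.Adj p.1 p.2)
    (fun p => H.degree p.1 + H.degree p.2)
    (by obtain ⟨u, v, h⟩ := hne; exact ⟨(u, v), by simpa using h⟩)
  simp only [Finset.mem_filter, Finset.mem_univ, true_and, Prod.forall] at hmem hmax
  wlog hle : H.degree u ≤ H.degree v generalizing u v
  · exact this v u ⟨hmem.1.symm, fun h => hmem.2 h.symm⟩
      (fun a b hab => (hmax a b hab).trans (add_comm _ _).le) (by omega)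
  have huv := hore u v hmem.1 hmem.2
  have hltn : ∀ w, H.degree w < n := fun w => hn ▸ H.degree_lt_card_verts w
  set k := H.degree u with hk
  let B := Finset.univ.filter fun w => ¬ H.Adj u w
  let A := (Finset.univ.filter fun w => ¬ H.Adj v w).erase v
  have hBcard : B.card = n - k := by rw [← hn]; exact H.card_filter_not_adj u
  have hAcard : A.card = n - H.degree v - 1 := by
    rw [Finset.card_erase_of_mem (by simp), H.card_filter_not_adj v, hn]
  have hB : ∀ w ∈ B, H.degree w ≤ n - k := by
    intro w hw
    by_cases hwu : w = u
    · subst hwu; omega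
    · have := hmax u w ⟨fun h => hwu h.symm, by simpa [B] using hw⟩
      omega
  have hA : ∀ w ∈ A, H.degree w ≤ k := by
    intro w hw
    simp only [A, Finset.mem_erase, Finset.mem_filter, Finset.mem_univ, true_and] at hw
    have := hmax w v ⟨hw.1, fun h => hw.2 h.symm⟩
    omega
  refine ⟨k, B, ⟨u, rfl⟩, by omega, hBcard, hB, ?_⟩
  have hk0 := hpos u
  -- The terms for `A` and `B` are chosen so that the bound is the degree `k` on `A ∩ B`, `n - k` on
  -- `B \ A`, and `2 * k - 1 ≥ k` on `A \ B`.
  have hterm : ∀ w, (H.degree w : ℤ) + (if w ∈ B then ((k : ℤ) - 1) else 0)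
      + (if w ∈ A then ((n : ℤ) - 2 * k) else 0) ≤ n - 1 := by
    intro w
    have := hltn w
    by_cases hwB : w ∈ B <;> by_cases hwA : w ∈ A <;> simp only [hwA, hwB, if_true, if_false]
    · have := hA w hwA; omega
    · have := hB w hwB; omega
    · have := hA w hwA; omega
    · omega
  have hsum := Finset.sum_le_sum fun w (_ : w ∈ Finset.univ) => hterm w
  simp only [Finset.sum_add_distrib, Finset.sum_ite_mem, Finset.univ_inter, Finset.sum_const,
    Finset.card_univ, hn, hBcard, hAcard, nsmul_eq_mul] at hsum
  have e1 : ((n - k : ℕ) : ℤ) = n - k := by omega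
  have e2 : (k : ℤ) - 1 ≤ ((n - H.degree v - 1 : ℕ) : ℤ) := by omega
  have e3 : (0 : ℤ) ≤ n - 2 * k := by omega
  rw [e1] at hsum
  push_cast
  nlinarith [mul_le_mul_of_nonneg_right e2 e3]

/-- The extremal case of `exists_sum_degree_add_le` with `n = 2 * k`: the vertices outside `B`
are adjacent to all others, which uses up the degrees of the vertices in `B`. -/
theorem isIndep_of_sum_degree_ge {k : ℕ} (hn : Fintype.card V = 2 * k) {B : Finset V}
    (hB : B.card = k) (hdeg : ∀ w ∈ B, H.degree w ≤ k)
    (hsum : k * k + k * (2 * k - 1) ≤ ∑ w, H.degree w) :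
    ∀ u ∈ B, ∀ v ∈ B, ¬ H.Adj u v := by
  have hBc : Bᶜ.card = k := by rw [Finset.card_compl, hn, hB]; omega
  have hlt : ∀ w, H.degree w ≤ 2 * k - 1 := fun w => by
    have := H.degree_lt_card_verts w; omega
  have h1 : ∑ w ∈ B, H.degree w ≤ k * k := by
    simpa [hB] using Finset.sum_le_card_nsmul B _ k hdeg
  have h2 : ∀ w ∈ Bᶜ, H.degree w = 2 * k - 1 := by
    by_contra! hcon
    obtain ⟨w, hw, hne⟩ := hcon
    have := Finset.sum_lt_sum (s := Bᶜ) (f := fun w => H.degree w) (g := fun _ => 2 * k - 1)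
      (fun w _ => hlt w) ⟨w, hw, lt_of_le_of_ne (hlt w) hne⟩
    rw [Finset.sum_const, hBc, smul_eq_mul] at this
    rw [← Finset.sum_add_sum_compl B] at hsum
    omega
  have hadj : ∀ w ∈ Bᶜ, ∀ x, x ≠ w → H.Adj w x := by
    intro w hw x hx
    have hsub : H.neighborFinset w ⊆ Finset.univ.erase w := fun y hy => by
      have := (H.mem_neighborFinset w y).1 hy
      simp [this.ne']
    have := Finset.eq_of_subset_of_card_le hsub (by
      rw [card_neighborFinset_eq_degree, h2 w hw, Finset.card_erase_of_mem (Finset.mem_univ _),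
        Finset.card_univ, hn])
    rw [← mem_neighborFinset, this]
    simp [hx]
  intro u hu v hv huv
  have hsub : Bᶜ ⊆ H.neighborFinset u := fun w hw => by
    rw [mem_neighborFinset]
    exact (hadj w hw u fun h => (Finset.mem_compl.1 hw) (h ▸ hu)).symm
  have := Finset.eq_of_subset_of_card_le hsub (by
    rw [card_neighborFinset_eq_degree, hBc]; exact hdeg u hu)
  have hv' : v ∈ Bᶜ := by rw [this, mem_neighborFinset]; exact huv
  exact Finset.mem_compl.1 hv' hv

end SimpleGraph

/-! ### Deriving the theorem -/

namespace SimpleGraph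

/-- The bound on the spectral radius forces many edges in a supergraph `H` of `G`: the Rayleigh
quotient of the all-ones vector bounds the transmissions, and so the missing edges. The inequality
is strict because equality would make `G` transmission regular, contradicting the Ore condition
on `H` at a non-adjacent pair. -/
theorem lt_sum_degree {V : Type*} [Fintype V] [DecidableEq V] (G H : SimpleGraph V)
    [DecidableRel H.Adj] {n : ℕ} (hn : Fintype.card V = n) (hn0 : 0 < n) (hconn : G.Connected)
    (hGH : G ≤ H) (hne : ∃ u v, u ≠ v ∧ ¬ H.Adj u v)
    (hore : ∀ u v, u ≠ v → ¬ H.Adj u v → H.degree u + H.degree v ≤ n)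
    (hρ : G.distanceSignlessSpectralRadius ≤ (2 * (n : ℝ) ^ 2 + 6 * (n : ℝ) - 36) / (n : ℝ)) :
    (n : ℤ) ^ 2 - 5 * n + 18 < (∑ w, H.degree w : ℕ) := by
  have hn' : (0 : ℝ) < n := by exact_mod_cast hn0
  have htr : ∀ u, 2 * (n : ℝ) ≤ G.transmission u + H.degree u + 2 := fun u => by
    exact_mod_cast hn ▸ G.two_mul_card_sub_le_transmission_add_degree hconn hGH u
  rw [le_div_iff₀ hn'] at hρ
  have hle := G.two_mul_sum_transmission_le
  rw [hn] at hle
  have hstrict : 2 * ∑ u, (G.transmission u : ℝ) < G.distanceSignlessSpectralRadius * n := by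
    refine lt_of_le_of_ne hle fun heq => ?_
    -- Otherwise all transmissions are `ρ / 2`. A non-adjacent pair then gives `ρ ≥ 3 * n - 4`,
    -- which exceeds the assumed bound because `n ^ 2 - 10 * n + 36 = (n - 5) ^ 2 + 11 > 0`.
    have hreg := G.two_mul_transmission_eq_of_two_mul_sum_eq (by rw [hn]; exact heq)
    obtain ⟨u, v, huv, hadj⟩ := hne
    have hsum : (H.degree u : ℝ) + H.degree v ≤ n := by exact_mod_cast hore u v huv hadj
    have h1 := htr u
    have h2 := htr v
    have h3 := hreg u
    have h4 := hreg v
    have h5 : 3 * (n : ℝ) - 4 ≤ G.distanceSignlessSpectralRadius := by linarith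
    have h6 := mul_le_mul_of_nonneg_right h5 hn'.le
    nlinarith [sq_nonneg ((n : ℝ) - 5)]
  have hsum := Finset.sum_le_sum fun u (_ : u ∈ Finset.univ) => htr u
  simp only [Finset.sum_add_distrib, Finset.sum_const, Finset.card_univ, hn, nsmul_eq_mul] at hsum
  have : (n : ℝ) ^ 2 - 5 * n + 18 < ((∑ w, H.degree w : ℕ) : ℝ) := by
    push_cast
    nlinarith
  exact_mod_cast this

end SimpleGraph

theorem theorem2p6 {V : Type*} [Fintype V] [DecidableEq V] (G : SimpleGraph V)
    [DecidableRel G.Adj] (n : ℕ) (hn : Fintype.card V = n) (hn5 : 5 ≤ n)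
    (hconn : G.Connected) (hδ : 3 ≤ G.minDegree)
    (hρ : G.distanceSignlessSpectralRadius ≤ (2 * (n : ℝ) ^ 2 + 6 * (n : ℝ) - 36) / (n : ℝ)) :
    G.IsHamiltonConnected := by
  intro s t hst
  by_contra hno
  obtain ⟨H, _, hGH, hne, hore⟩ :=
    SimpleGraph.exists_le_degree_add_degree_le hst (fun ⟨l, hl⟩ => hno hl.exists_walk)
  rw [hn] at hore
  have hdeg : ∀ u, 3 ≤ H.degree u := fun u =>
    hδ.trans ((G.minDegree_le_degree u).trans (SimpleGraph.degree_le_of_le hGH))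
  have hlt := G.lt_sum_degree H hn (by omega) hconn hGH hne hore hρ
  obtain ⟨k, B, ⟨u, hu⟩, hkn, hBcard, hBdeg, hle⟩ := H.exists_sum_degree_add_le hn
    (fun u => by have := hdeg u; omega) hne hore
  have hk3 : 3 ≤ k := hu ▸ hdeg u
  -- The two estimates of the degree sum differ by `(k - 1) * (2 * n - 3 * k) - (4 * n - 18)`, which
  -- factors because it vanishes at `k = 3`.
  have hneg : ((k : ℤ) - 3) * (2 * n - 3 * k - 6) < 0 := by nlinarith
  have hk4 : 4 ≤ k := by
    by_contra hcon
    obtain rfl : k = 3 := by omega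
    simp at hneg
  have h2n : 2 * n < 3 * k + 6 := by
    by_contra hcon
    have h1 : (0 : ℤ) ≤ (k : ℤ) - 3 := by omega
    have h2 : (0 : ℤ) ≤ 2 * n - 3 * k - 6 := by omega
    exact absurd (mul_nonneg h1 h2) (not_le.2 hneg)
  have hcases : (k = 4 ∧ n = 8) ∨ (k = 5 ∧ n = 10) := by omega
  -- The degree sum is even, so in both cases it attains its maximum `n * (n - 1) - k * (k - 1)`.
  have heven := H.sum_degrees_eq_twice_card_edges
  rcases hcases with ⟨rfl, rfl⟩ | ⟨rfl, rfl⟩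
  · have hind := H.isIndep_of_sum_degree_ge (k := 4) hn hBcard hBdeg (by omega)
    have := G.sub_le_five_mul_spectralRadius_of_isIndep hconn (k := 4) (by norm_num) hn B hBcard
      fun u hu v hv h => hind u hu v hv (hGH h)
    norm_num at this hρ
    linarith
  · have hind := H.isIndep_of_sum_degree_ge (k := 5) hn hBcard hBdeg (by omega)
    have := G.sub_le_five_mul_spectralRadius_of_isIndep hconn (k := 5) (by norm_num) hn B hBcard
      fun u hu v hv h => hind u hu v hv (hGH h)
    norm_num at this hρ
    linarith
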